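/- Let $\mathcal{C}$ be a small category with a terminal object $1$ such that every object $X$ has a point $1 \to X$, and let $p : \mathrm{Psh}(\mathcal{C}) \to \mathbf{Set}$ be the canonical geometric morphism: $p^*$ sends a set to the corresponding constant presheaf, $p_* X = X(1)$, and $p_*$ has a fully faithful right adjoint $p^!$, with $(p^! A)(X) = A^{\mathcal{C}(1, X)}$. A geometric morphism $q : \mathcal{Q} \to \mathcal{S}$ is *local* if $q_*$ has a fully faithful right adjoint $q^!$; it is a *quality type* if, moreover, the canonical transformation $\phi : q^* \to q^!$ (the unit of $q_* \dashv q^!$ at $q^*$ followed by $q^!$ of the inverse of the unit of $q^* \dashv q_*$) is an isomorphism. A subtopos $k$ of a topos is *above* a subtopos $j$ if $j_*$ factors up to isomorphism through $k_*$; a subtopos $j$ is *essential* if $j^*$ has a left adjoint. A *subquality* of $p$ is a subtopos $j$ of $\mathrm{Psh}(\mathcal{C})$ that is above the centre $p_* \dashv p^! : \mathbf{Set} \to \mathrm{Psh}(\mathcal{C})$ of $p$ and for which the composite $pj$ is a quality type. *Level $\epsilon$* of $p$ is, if it exists, the largest (for the relation "above") essential subquality of $p$. A morphism $f : D \to C$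 of $\mathcal{C}$ is a *pseudo-constant* if $fa = fb$ for all points $a, b : 1 \to D$. Let $\mathcal{C}_!$ be the full subcategory of $\mathcal{C}$ on the objects with exactly one point, and let $\mathrm{Psh}(\mathcal{C}_!) \to \mathrm{Psh}(\mathcal{C})$ be the induced subtopos, whose inverse image is restriction of presheaves along $\mathcal{C}_! \to \mathcal{C}$. Assume that $\mathcal{C}$ has *enough little figures*, that is, every pseudo-constant factors through an object with exactly one point. Then $\mathrm{Psh}(\mathcal{C}_!) \to \mathrm{Psh}(\mathcal{C})$ is level $\epsilon$ of $p$, and it is also the largest subquality of $p$ (every subquality of $p$, essential or not, lies below it). -/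

import Mathlib

universe v₁ v₂ v₃ u₁ u₂ u₃ u w w'

open CategoryTheory Limits Opposite

noncomputable section

/-- A geometric morphism `F ⟶ E`: a direct image functor with a finite-limit-preserving left
adjoint, the inverse image functor. It is used below only between toposes. -/
structure GeomMorphism (F : Type u₁) [Category.{v₁} F] (E : Type u₂) [Category.{v₂} E] where
  /-- The direct image `f_*`. -/
  direct : F ⥤ E
  /-- The inverse image `f^*`. -/
  inverse : E ⥤ F
  /-- The adjunction `f^* ⊣ f_*`. -/
  adj : inverse ⊣ direct
  preservesFiniteLimits : PreservesFiniteLimits inverse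

namespace GeomMorphism

variable {G : Type u₃} [Category.{v₃} G] {F : Type u₁} [Category.{v₁} F]
  {E : Type u₂} [Category.{v₂} E]

/-- The composite `G ⟶ F ⟶ E` of geometric morphisms. -/
def comp (g : GeomMorphism G F) (f : GeomMorphism F E) : GeomMorphism G E where
  direct := g.direct ⋙ f.direct
  inverse := f.inverse ⋙ g.inverse
  adj := f.adj.comp g.adj
  preservesFiniteLimits :=
    haveI := f.preservesFiniteLimits
    haveI := g.preservesFiniteLimits
    comp_preservesFiniteLimits _ _

/-- `j : F ⟶ E` is (the inclusion of) a subtopos of the topos `E`: its direct image is fully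
faithful. (A category `F` with a finite-limit-preserving adjunction of this kind to a topos `E`
is itself a topos, so this need not be demanded of `F`.) -/
def IsSubtopos (j : GeomMorphism F E) : Prop :=
  j.direct.Full ∧ j.direct.Faithful

/-- A geometric morphism is essential if its inverse image has a left adjoint. -/
def IsEssential (j : GeomMorphism F E) : Prop :=
  j.inverse.IsRightAdjoint

/-- The subtopos `k` of `E` is above the subtopos `j` of `E`: the direct image of `j` factors, up
to isomorphism, through that of `k`. -/
def IsAbove (k : GeomMorphism G E) (j : GeomMorphism F E) : Prop :=
  ∃ K : F ⥤ G, Nonempty (K ⋙ k.direct ≅ j.direct)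

end GeomMorphism

/-- A local geometric morphism `p : E ⟶ S`: the direct image `p_*` has a fully faithful right
adjoint `p^!`. -/
structure LocalGeomMorphism (E : Type u₁) [Category.{v₁} E] (S : Type u₂) [Category.{v₂} S]
    extends GeomMorphism E S where
  /-- The right adjoint `p^!` of the direct image. -/
  upperShriek : S ⥤ E
  /-- The adjunction `p_* ⊣ p^!`. -/
  adjShriek : direct ⊣ upperShriek
  full : upperShriek.Full
  faithful : upperShriek.Faithful

namespace LocalGeomMorphism

variable {E : Type u₁} [Category.{v₁} E] {S : Type u₂} [Category.{v₂} S]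

/-- The adjoint triple `p^* ⊣ p_* ⊣ p^!`. -/
def triple (p : LocalGeomMorphism E S) :
    Adjunction.Triple p.inverse p.direct p.upperShriek where
  adj₁ := p.adj
  adj₂ := p.adjShriek

theorem inverse_full (p : LocalGeomMorphism E S) : p.inverse.Full :=
  haveI := p.full
  haveI := p.faithful
  (p.triple.fullyFaithfulEquiv.symm (.ofFullyFaithful p.upperShriek)).full

theorem inverse_faithful (p : LocalGeomMorphism E S) : p.inverse.Faithful :=
  haveI := p.full
  haveI := p.faithful
  (p.triple.fullyFaithfulEquiv.symm (.ofFullyFaithful p.upperShriek)).faithful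

/-- The canonical transformation `φ : p^* ⟶ p^!`: the unit of `p_* ⊣ p^!` at `p^*`, followed by
the inverse of `p^!` applied to the unit of `p^* ⊣ p_*`. -/
def phi (p : LocalGeomMorphism E S) : p.inverse ⟶ p.upperShriek :=
  haveI := p.full
  haveI := p.faithful
  haveI := p.inverse_full
  haveI := p.inverse_faithful
  p.triple.leftToRight

/-- The centre `p_* ⊣ p^! : S ⟶ E` of a local geometric morphism `p : E ⟶ S` (level `0`). -/
def centre (p : LocalGeomMorphism E S) : GeomMorphism S E where
  direct := p.upperShriek
  inverse := p.direct
  adj := p.adjShriek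
  preservesFiniteLimits := ⟨fun _ _ _ => p.adj.rightAdjoint_preservesLimits.preservesLimitsOfShape⟩

end LocalGeomMorphism

/-- A geometric morphism `q` is a quality type if it is local and the canonical transformation
`φ : q^* ⟶ q^!` is an isomorphism. (As right adjoints are unique up to isomorphism, the choice of
`q^!` is immaterial.) -/
def GeomMorphism.IsQualityType {Q : Type u₁} [Category.{v₁} Q] {S : Type u₂} [Category.{v₂} S]
    (q : GeomMorphism Q S) : Prop :=
  ∃ l : LocalGeomMorphism Q S, l.toGeomMorphism = q ∧ IsIso l.phi

namespace LocalGeomMorphism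

variable {E : Type u₁} [Category.{v₁} E] {S : Type u₂} [Category.{v₂} S]

/-- A subquality of `p : E ⟶ S` is a subtopos `j` of `E`, above the centre of `p`, such that the
composite of `j` and `p` is a quality type. -/
def IsSubquality (p : LocalGeomMorphism E S) {F : Type u₃} [Category.{v₃} F]
    (j : GeomMorphism F E) : Prop :=
  j.IsSubtopos ∧ j.IsAbove p.centre ∧ (j.comp p.toGeomMorphism).IsQualityType

/-- `j` is the largest subquality of `p`. The universes `w`, `w'` are those of the other
subqualities. -/
def IsLargestSubquality (p : LocalGeomMorphism E S) {F : Type u₃} [Category.{v₃} F]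
    (j : GeomMorphism F E) : Prop :=
  p.IsSubquality j ∧
    ∀ (G : Type w) [Category.{w'} G] (k : GeomMorphism G E), p.IsSubquality k → j.IsAbove k

/-- `j` is level `ε` of `p`: the largest essential subquality of `p`. The universes `w`, `w'` are
those of the other subqualities. -/
def IsLevelEpsilon (p : LocalGeomMorphism E S) {F : Type u₃} [Category.{v₃} F]
    (j : GeomMorphism F E) : Prop :=
  (p.IsSubquality j ∧ j.IsEssential) ∧
    ∀ (G : Type w) [Category.{w'} G] (k : GeomMorphism G E),
      p.IsSubquality k → k.IsEssential → j.IsAbove k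

end LocalGeomMorphism

namespace PresheafTopos

variable {C : Type u} [SmallCategory C]

section Canonical

variable (C) [HasTerminal C]

/-- The functor sending a set `A` to the presheaf `X ↦ A ^ C(1, X)`. -/
def pointsPower : Type u ⥤ (Cᵒᵖ ⥤ Type u) where
  obj A :=
    { obj := fun X => (⊤_ C ⟶ X.unop) → A
      map := fun f => ↾fun (g : (⊤_ C ⟶ _) → A) a => g (a ≫ f.unop) }
  map h := { app := fun _ => ↾fun g a => h (g a) }

/-- Constant presheaves are left adjoint to evaluation at the terminal object. -/
def constAdj :
    Functor.const Cᵒᵖ ⊣ (evaluation Cᵒᵖ (Type u)).obj (op (⊤_ C)) :=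
  Adjunction.mkOfUnitCounit
    { unit := { app := fun _ => 𝟙 _ }
      counit :=
        { app := fun X =>
            { app := fun Y => X.map (terminal.from Y.unop).op
              naturality := fun Y Z f => by
                dsimp
                rw [Category.id_comp, ← X.map_comp]
                congr 1
                apply Quiver.Hom.unop_inj
                exact Subsingleton.elim _ _ } }
      left_triangle := by
        ext A Y x
        simp
      right_triangle := by
        ext X x
        have : (terminal.from (⊤_ C)).op = 𝟙 (op (⊤_ C)) := by
          apply Quiver.Hom.unop_inj
          exact Subsingleton.elim _ _
        simp [this] }

/-- Evaluation at the terminal object is left adjoint to `A ↦ A ^ C(1, -)`. -/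
def pointsPowerAdj :
    (evaluation Cᵒᵖ (Type u)).obj (op (⊤_ C)) ⊣ pointsPower C :=
  Adjunction.mkOfUnitCounit
    { unit :=
        { app := fun X =>
            { app := fun Y => ↾fun (x : X.obj Y) (a : ⊤_ C ⟶ Y.unop) => X.map a.op x
              naturality := fun Y Z f => by
                ext x
                funext a
                simp [pointsPower] }
          naturality := fun X Y f => by
            ext Z x
            funext a
            simp [pointsPower] }
      counit :=
        { app := fun A => ↾fun (g : (⊤_ C ⟶ ⊤_ C) → A) => g (𝟙 _) }
      left_triangle := by
        ext X x
        simp [pointsPower]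
      right_triangle := by
        ext A Y g
        funext a
        change g (𝟙 _ ≫ a) = g a
        rw [Category.id_comp] }

instance pointsPower_isIso_counit : IsIso (pointsPowerAdj C).counit := by
  rw [NatTrans.isIso_iff_isIso_app]
  intro A
  rw [isIso_iff_bijective]
  constructor
  · intro g g' h
    funext a
    have ha : a = 𝟙 _ := Subsingleton.elim _ _
    subst ha
    exact h
  · intro a
    exact ⟨fun _ => a, rfl⟩

/-- For `C` with a terminal object, the canonical geometric morphism `p : Psh(C) ⟶ Set`:
`p^* A` is the constant presheaf at `A`, `p_* X = X(1)`, and `p^! A = A ^ C(1, -)`. -/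
def canonical : LocalGeomMorphism (Cᵒᵖ ⥤ Type u) (Type u) where
  direct := (evaluation Cᵒᵖ (Type u)).obj (op (⊤_ C))
  inverse := Functor.const Cᵒᵖ
  adj := constAdj C
  preservesFiniteLimits := ⟨fun _ _ _ => inferInstance⟩
  upperShriek := pointsPower C
  adjShriek := pointsPowerAdj C
  full := (pointsPowerAdj C).fullyFaithfulROfIsIsoCounit.full
  faithful := (pointsPowerAdj C).fullyFaithfulROfIsIsoCounit.faithful

end Canonical

/-- The geometric morphism `Psh(D) ⟶ Psh(C)` induced by a full subcategory `D` of `C`: the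
inverse image is restriction of presheaves, the direct image is right Kan extension. -/
def ofFullSubcategory (P : ObjectProperty C) :
    GeomMorphism (P.FullSubcategoryᵒᵖ ⥤ Type u) (Cᵒᵖ ⥤ Type u) where
  direct := P.ι.op.ran
  inverse := (Functor.whiskeringLeft _ _ (Type u)).obj P.ι.op
  adj := P.ι.op.ranAdjunction (Type u)
  preservesFiniteLimits := ⟨fun _ _ _ => inferInstance⟩

variable (C) [HasTerminal C]

/-- The objects of `C` with exactly one point; the corresponding full subcategory is `C_!`. -/
def hasUniquePoint : ObjectProperty C := fun X => ∃! _ : ⊤_ C ⟶ X, True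

variable {C}

/-- A morphism is a pseudo-constant if it is constant on points. -/
def IsPseudoConstant {X Y : C} (f : X ⟶ Y) : Prop :=
  ∀ a b : ⊤_ C ⟶ X, a ≫ f = b ≫ f

variable (C)

/-- Every pseudo-constant factors through an object with exactly one point. -/
def HasEnoughLittleFigures : Prop :=
  ∀ ⦃X Y : C⦄ (f : X ⟶ Y), IsPseudoConstant f →
    ∃ (B : C) (g : X ⟶ B) (h : B ⟶ Y), hasUniquePoint C B ∧ g ≫ h = f

end PresheafTopos

end

/-! Take A = C(1, X). The diagonal p^* A → p^! A is inverted by p_*, and its pullback along yX → p^!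
A is the sieve of pseudo-constants into X (`isPullback_pseudoConstants`). Let k be a subquality and
q = pk. Since k is above the centre, k^* p^! ≅ q^!, and q^! ≅ q^* by quality. So k^* sends the
diagonal to a map between objects in the image of the fully faithful q^*; it is inverted by q_*,
hence invertible. As k^* is left exact, it inverts every sieve of pseudo-constants.

With enough little figures, these sieves consist of the maps factoring through one-point objects.
Sheaves for them are determined by their restriction to C_!, so k lies below Psh(C_!). No
essentiality of k is used, so both maximality claims follow at once.

Conversely, in C_! the object 1 is also weakly initial with unique maps, so evaluation at 1 is both
left and right adjoint to the constant presheaf functor: Psh(C_!) is itself a subquality. -/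

noncomputable section

/-! ### Fully faithful left adjoints and orthogonality -/

namespace CategoryTheory

variable {E : Type u₁} [Category.{v₁} E] {S : Type u₂} [Category.{v₂} S]

/-- For a fully faithful `F ⊣ G`, a morphism between objects in the essential image of `F` is
invertible as soon as its image under `G` is. -/
theorem Adjunction.isIso_of_isIso_map {F : S ⥤ E} {G : E ⥤ S} (adj : F ⊣ G) [F.Full] [F.Faithful]
    {A B : S} {X : E} (e : X ≅ F.obj B) (f : F.obj A ⟶ X)
    (hf : IsIso (G.map f)) : IsIso f := by
  obtain ⟨g, hg⟩ := F.map_surjective (f ≫ e.hom)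
  have hGF : IsIso (G.map (F.map g)) := by
    rw [hg, G.map_comp]
    infer_instance
  have hg' : IsIso g := by
    have h := adj.unit.naturality g
    have : g = adj.unit.app A ≫ G.map (F.map g) ≫ inv (adj.unit.app B) := by
      rw [← Category.assoc, IsIso.eq_comp_inv]
      exact h
    rw [this]
    infer_instance
  have : f = F.map g ≫ e.inv := by rw [hg]; simp
  rw [this]
  infer_instance

/-- An object in the image of a right adjoint is orthogonal to the morphisms inverted by the left
adjoint. -/
theorem Adjunction.existsUnique_comp_eq {L : E ⥤ S} {R : S ⥤ E} (adj : L ⊣ R) {X Y : E}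
    (f : X ⟶ Y) [IsIso (L.map f)] {A : S} (g : X ⟶ R.obj A) : ∃! h : Y ⟶ R.obj A, f ≫ h = g := by
  refine ⟨adj.homEquiv _ _ (inv (L.map f) ≫ (adj.homEquiv _ _).symm g), ?_, fun h hh => ?_⟩
  · apply (adj.homEquiv _ _).symm.injective
    simp [Adjunction.homEquiv_naturality_left_symm]
  · apply (adj.homEquiv _ _).symm.injective
    rw [Equiv.symm_apply_apply, IsIso.eq_inv_comp, ← Adjunction.homEquiv_naturality_left_symm, hh]

end CategoryTheory

/-! ### Recognising quality types -/

namespace LocalGeomMorphism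

variable {E : Type u₁} [Category.{v₁} E] {S : Type u₂} [Category.{v₂} S]

/-- The canonical transformation `φ` is invertible if the values of `q^*` and `q^!` are isomorphic
in any way whatsoever. -/
theorem isIso_phi_of_iso (l : LocalGeomMorphism E S)
    (e : ∀ A, Nonempty (l.upperShriek.obj A ≅ l.inverse.obj A)) : IsIso l.phi := by
  have := l.full
  have := l.faithful
  have := l.inverse_full
  have := l.inverse_faithful
  rw [NatTrans.isIso_iff_isIso_app]
  intro A
  -- Both factors of `l.phi` become invertible under q_*: the unit of q_* ⊣ q^! because q^! is fully
  -- faithful.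
  have : IsIso (l.direct.map (l.phi.app A)) := by
    have h : l.phi.app A = l.adjShriek.unit.app (l.inverse.obj A) ≫
        inv (l.upperShriek.map (l.adj.unit.app A)) := l.triple.leftToRight_app
    rw [h, Functor.map_comp]
    infer_instance
  exact l.adj.isIso_of_isIso_map (e A).some _ this

end LocalGeomMorphism

/-! ### What the inverse image of a subquality inverts -/

namespace GeomMorphism

variable {E : Type u₁} [Category.{v₁} E] {S : Type u₂} [Category.{v₂} S]
  {F : Type u₃} [Category.{v₃} F]

/-- If the subtopos `k` is above the centre of `p`, via `K`, then `K` is right adjoint to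
`p_* k_*`. -/
def adjOfAboveCentre (p : LocalGeomMorphism E S) (k : GeomMorphism F E) (hk : k.IsSubtopos)
    (K : S ⥤ F) (e : K ⋙ k.direct ≅ p.upperShriek) : k.direct ⋙ p.direct ⊣ K :=
  haveI := hk.1
  haveI := hk.2
  p.adjShriek.restrictFullyFaithful (.ofFullyFaithful k.direct) (.id S)
    (Functor.rightUnitor _).symm (Functor.leftUnitor _ ≪≫ e.symm)

/-- If the subtopos `k` is above the centre of `p`, then `p_* k_* k^*` is isomorphic to `p_*`. -/
def inverseCompDirectIso (p : LocalGeomMorphism E S) (k : GeomMorphism F E) (hk : k.IsSubtopos)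
    (K : S ⥤ F) (e : K ⋙ k.direct ≅ p.upperShriek) :
    k.inverse ⋙ k.direct ⋙ p.direct ≅ p.direct :=
  (k.adj.comp (adjOfAboveCentre p k hk K e)).leftAdjointUniq (p.adjShriek.ofNatIsoRight e.symm)

/-- For a subquality `k` of `p`, the inverse image `k^*` inverts every morphism `p^* A ⟶ p^! B`
that is inverted by `p_*`. -/
theorem isIso_inverse_map_of_isSubquality {p : LocalGeomMorphism E S} {k : GeomMorphism F E}
    (hk : p.IsSubquality k) {A B : S} (f : p.inverse.obj A ⟶ p.upperShriek.obj B)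
    [IsIso (p.direct.map f)] : IsIso (k.inverse.map f) := by
  obtain ⟨hs, ⟨K, ⟨e⟩⟩, ⟨l, hl, hphi⟩⟩ := hk
  obtain ⟨q, R, adjR, hfull, hfaith⟩ := l
  obtain rfl : q = _ := hl
  let l : LocalGeomMorphism F S := ⟨k.comp p.toGeomMorphism, R, adjR, hfull, hfaith⟩
  have := l.inverse_full
  have := l.inverse_faithful
  have := hs.1
  have := hs.2
  let i₁ : k.inverse.obj (p.upperShriek.obj B) ≅ K.obj B :=
    k.inverse.mapIso (e.symm.app B) ≪≫ asIso (k.adj.counit.app (K.obj B))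
  -- Both functors are right adjoint to p_* k_*.
  let i₂ : K.obj B ≅ l.upperShriek.obj B :=
    ((adjOfAboveCentre p k hs K e).rightAdjointUniq l.adjShriek).app B
  let i₃ : l.inverse.obj B ≅ l.upperShriek.obj B := asIso (l.phi.app B)
  have : IsIso (l.direct.map (k.inverse.map f)) :=
    (NatIso.isIso_map_iff (inverseCompDirectIso p k hs K e) f).2 inferInstance
  -- The domain k^* p^* A is `l.inverse.obj A` by definition.
  exact l.adj.isIso_of_isIso_map (F := l.inverse) (A := A) (B := B) (i₁ ≪≫ i₂ ≪≫ i₃.symm)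
    (k.inverse.map f) this

/-- The direct image of a geometric morphism takes values in sheaves for the sieves that its
inverse image inverts. -/
theorem isSheafFor_direct_obj {C : Type u} [SmallCategory C] (k : GeomMorphism F (Cᵒᵖ ⥤ Type u))
    {X : C} (T : Sieve X) [IsIso (k.inverse.map T.functorInclusion)] (G : F) :
    Presieve.IsSheafFor (k.direct.obj G) T.arrows :=
  Presieve.isSheafFor_iff_yonedaSheafCondition.2 fun f => k.adj.existsUnique_comp_eq _ f

end GeomMorphism

/-! ### Sieves of pseudo-constants -/

namespace PresheafTopos

variable {C : Type u} [SmallCategory C]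

section Canonical

variable (C) [HasTerminal C]

/-- The diagonal `A ⟶ A ^ C(1, X)`. -/
def diagonal (A : Type u) : (canonical C).inverse.obj A ⟶ (canonical C).upperShriek.obj A where
  app X := ↾fun (x : A) => (fun _ => x : (⊤_ C ⟶ X.unop) → A)

instance (A : Type u) : IsIso ((canonical C).direct.map (diagonal C A)) := by
  rw [isIso_iff_bijective]
  refine ⟨fun x y h => congr_fun h (𝟙 (⊤_ C)), fun g => ⟨(g : (⊤_ C ⟶ ⊤_ C) → A) (𝟙 _), ?_⟩⟩
  funext a
  have ha : a = 𝟙 _ := Subsingleton.elim _ _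
  subst ha
  rfl

variable {C}

/-- The sieve of pseudo-constants with codomain `X`. -/
def pseudoConstants (X : C) : Sieve X where
  arrows _ f := IsPseudoConstant f
  downward_closed {Y Z f} hf g a b := by
    simpa using hf (a ≫ g) (b ≫ g)

/-- A map f : Y → X lands in the diagonal exactly when all its composites with points of Y agree.
Since Y has a point, the common value is determined by f, whence `u`. -/
theorem isPullback_pseudoConstants (hpoint : ∀ X : C, Nonempty (⊤_ C ⟶ X)) (X : C) :
    ∃ (u : (pseudoConstants X).functor ⟶ (canonical C).inverse.obj (⊤_ C ⟶ X))
      (v : yoneda.obj X ⟶ (canonical C).upperShriek.obj (⊤_ C ⟶ X)),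
      IsPullback (pseudoConstants X).functorInclusion u v (diagonal C _) := by
  refine ⟨{ app := fun Y => ↾fun f => (hpoint Y.unop).some ≫ f.1
            naturality := fun Y Z g => ?_ },
    { app := fun Y => ↾fun (f : Y.unop ⟶ X) => (fun a => a ≫ f : (⊤_ C ⟶ Y.unop) → (⊤_ C ⟶ X))
      naturality := fun Y Z g => ?_ }, ?_⟩
  · ext f
    exact (Category.assoc _ _ _).symm.trans (f.2 _ _)
  · ext f
    funext a
    exact (Category.assoc _ _ _).symm
  · refine IsPullback.of_forall_isPullback_app fun Y => (Types.isPullback_iff _ _ _ _).2 ⟨?_, ?_, ?_⟩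
    · ext f
      funext a
      exact f.2 _ _
    · rintro f g ⟨h, -⟩
      exact Subtype.ext h
    · intro f x h
      have h' : ∀ a : ⊤_ C ⟶ Y.unop, a ≫ f = x := fun a => congr_fun h a
      exact ⟨⟨f, fun a b => (h' a).trans (h' b).symm⟩, rfl, h' _⟩

end Canonical

/-- The sieve of morphisms factoring through an object satisfying `P`. -/
def factorsThrough (P : ObjectProperty C) (X : C) : Sieve X where
  arrows Y f := ∃ (B : C) (g : Y ⟶ B) (h : B ⟶ X), P B ∧ g ≫ h = f
  downward_closed := by
    rintro Y Z f ⟨B, g, h, hB, rfl⟩ t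
    exact ⟨B, t ≫ g, h, hB, Category.assoc _ _ _⟩

theorem pseudoConstants_eq_factorsThrough [HasTerminal C] (hC : HasEnoughLittleFigures C) (X : C) :
    pseudoConstants X = factorsThrough (hasUniquePoint C) X := by
  ext Y f
  refine ⟨fun hf => hC f hf, ?_⟩
  rintro ⟨B, g, h, hB, rfl⟩ a b
  rw [← Category.assoc, ← Category.assoc, hB.unique (y₁ := a ≫ g) (y₂ := b ≫ g) trivial trivial]

/-- A morphism from a sheaf to a separated presheaf, for the sieves of morphisms factoring through
objects satisfying `P`, is invertible if it is so at the objects satisfying `P`. -/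
theorem isIso_of_isIso_app {P : ObjectProperty C} {F R : Cᵒᵖ ⥤ Type u}
    (hF : ∀ X, Presieve.IsSheafFor F (factorsThrough P X).arrows)
    (hR : ∀ X, Presieve.IsSeparatedFor R (factorsThrough P X).arrows)
    (η : F ⟶ R) (hη : ∀ B, P B → IsIso (η.app (op B))) : IsIso η := by
  have nat {X Y : C} (f : Y ⟶ X) (x : F.obj (op X)) :
      η.app (op Y) (F.map f.op x) = R.map f.op (η.app (op X) x) :=
    ConcreteCategory.congr_hom (η.naturality f.op) x
  have bij (B : C) (hB : P B) : Function.Bijective (η.app (op B)) :=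
    (isIso_iff_bijective _).1 (hη B hB)
  have inj (X : C) : Function.Injective (η.app (op X)) := by
    intro x y hxy
    refine (hF X).isSeparatedFor.ext fun Y f hf => ?_
    obtain ⟨B, g, h, hB, rfl⟩ := hf
    have : F.map h.op x = F.map h.op y := (bij B hB).1 (by rw [nat, nat, hxy])
    simp [this]
  rw [NatTrans.isIso_iff_isIso_app]
  rintro ⟨X⟩
  refine (isIso_iff_bijective _).2 ⟨inj X, fun y => ?_⟩
  have ex (Y : C) (f : Y ⟶ X) (hf : factorsThrough P X f) :
      ∃ x, η.app (op Y) x = R.map f.op y := by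
    obtain ⟨B, g, h, hB, rfl⟩ := hf
    obtain ⟨x, hx⟩ := (bij B hB).2 (R.map h.op y)
    exact ⟨F.map g.op x, by simp [nat, hx]⟩
  choose x hx using ex
  -- The local preimages match because their images under η, restrictions of the single element `y`,
  -- do and η is injective.
  obtain ⟨t, ht, -⟩ := hF X x (by
    intro Y₁ Y₂ Z g₁ g₂ f₁ f₂ h₁ h₂ w
    apply inj
    rw [nat, nat, hx, hx, ← Functor.map_comp_apply, ← Functor.map_comp_apply, ← op_comp, ← op_comp,
      w])
  exact ⟨t, (hR X).ext fun Y f hf => by rw [← nat, ht f hf, hx]⟩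

/-! ### The subtopos of a full subcategory -/

section FullSubcategory

variable (P : ObjectProperty C)

theorem isSubtopos_ofFullSubcategory : (ofFullSubcategory P).IsSubtopos :=
  haveI : IsIso (ofFullSubcategory P).adj.counit :=
    inferInstanceAs (IsIso (P.ι.op.ranAdjunction (Type u)).counit)
  have h := (ofFullSubcategory P).adj.fullyFaithfulROfIsIsoCounit
  ⟨h.full, h.faithful⟩

theorem isEssential_ofFullSubcategory : (ofFullSubcategory P).IsEssential :=
  (P.ι.op.lanAdjunction (Type u)).isRightAdjoint

instance isIso_inverse_map_functorInclusion (X : C) :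
    IsIso ((ofFullSubcategory P).inverse.map (factorsThrough P X).functorInclusion) := by
  rw [NatTrans.isIso_iff_isIso_app]
  rintro ⟨B⟩
  refine (isIso_iff_bijective _).2 ⟨fun f g h => Subtype.ext h, fun f => ?_⟩
  -- On objects satisfying `P` the sieve is maximal.
  exact ⟨⟨f, B.obj, 𝟙 _, f, B.property, Category.id_comp _⟩, rfl⟩

theorem isSheafFor_ofFullSubcategory_direct_obj (X : C) (H : P.FullSubcategoryᵒᵖ ⥤ Type u) :
    Presieve.IsSheafFor ((ofFullSubcategory P).direct.obj H) (factorsThrough P X).arrows :=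
  (ofFullSubcategory P).isSheafFor_direct_obj _ _

/-- A subtopos whose inverse image inverts the sieves of morphisms factoring through objects
satisfying `P` lies below the subtopos given by `P`. -/
theorem isAbove_ofFullSubcategory {F : Type u₁} [Category.{v₁} F]
    (k : GeomMorphism F (Cᵒᵖ ⥤ Type u))
    (hk : ∀ X, IsIso (k.inverse.map (factorsThrough P X).functorInclusion)) :
    (ofFullSubcategory P).IsAbove k := by
  have hs := isSubtopos_ofFullSubcategory P
  have := hs.1
  have := hs.2
  have h (G : F) : IsIso ((ofFullSubcategory P).adj.unit.app (k.direct.obj G)) := by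
    refine isIso_of_isIso_app (P := P) (fun X => k.isSheafFor_direct_obj _ G)
      (fun X => (isSheafFor_ofFullSubcategory_direct_obj P X _).isSeparatedFor) _ fun B hB => ?_
    -- The inverse image of a subtopos inverts the unit; its components are those of the unit at
    -- objects satisfying `P`.
    have : IsIso ((ofFullSubcategory P).inverse.map
        ((ofFullSubcategory P).adj.unit.app (k.direct.obj G))) := inferInstance
    exact (NatTrans.isIso_iff_isIso_app _).1 this (op ⟨B, hB⟩)
  have : IsIso (Functor.whiskerLeft k.direct (ofFullSubcategory P).adj.unit) :=
    (NatTrans.isIso_iff_isIso_app _).2 h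
  exact ⟨k.direct ⋙ (ofFullSubcategory P).inverse,
    ⟨(asIso (Functor.whiskerLeft k.direct (ofFullSubcategory P).adj.unit)).symm⟩⟩

end FullSubcategory

/-! ### The subtopos of one-point objects -/

section UniquePoint

variable (C) [HasTerminal C]

theorem hasUniquePoint_terminal : hasUniquePoint C (⊤_ C) :=
  ⟨𝟙 _, trivial, fun _ _ => Subsingleton.elim _ _⟩

/-- The terminal object as an object of `C_!`. -/
def littleTerminal : (hasUniquePoint C).FullSubcategory :=
  ⟨⊤_ C, hasUniquePoint_terminal C⟩

variable {C} in
/-- The point of an object of `C_!`. -/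
def littlePoint (B : (hasUniquePoint C).FullSubcategory) : littleTerminal C ⟶ B :=
  ObjectProperty.homMk B.property.choose

instance (B : (hasUniquePoint C).FullSubcategory) : Subsingleton (littleTerminal C ⟶ B) :=
  ⟨fun _ _ => ObjectProperty.hom_ext _ (B.property.unique trivial trivial)⟩

/-- On `C_!`, evaluation at the terminal object is left adjoint to the constant presheaf functor. -/
def evaluationConstAdj :
    (evaluation (hasUniquePoint C).FullSubcategoryᵒᵖ (Type u)).obj (op (littleTerminal C)) ⊣
      Functor.const (hasUniquePoint C).FullSubcategoryᵒᵖ :=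
  Adjunction.mkOfUnitCounit
    { unit :=
        { app := fun X =>
            { app := fun Y => X.map (littlePoint Y.unop).op
              naturality := fun Y Z f => by
                dsimp
                rw [Category.comp_id, ← X.map_comp]
                congr 1
                apply Quiver.Hom.unop_inj
                exact Subsingleton.elim _ _ } }
      counit := { app := fun _ => 𝟙 _ }
      left_triangle := by
        ext X x
        have : (littlePoint (littleTerminal C)).op = 𝟙 _ := by
          apply Quiver.Hom.unop_inj
          exact Subsingleton.elim _ _
        simp [this]
      right_triangle := by
        ext A Y x
        simp }

/-- Restricting to C_! and then evaluating at 1 is p_*, so the composite right adjoint must be p^!.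
-/
theorem isAbove_centre_ofFullSubcategory :
    (ofFullSubcategory (hasUniquePoint C)).IsAbove (canonical C).centre :=
  ⟨Functor.const _, ⟨((ofFullSubcategory (hasUniquePoint C)).adj.comp
    (evaluationConstAdj C)).rightAdjointUniq (canonical C).adjShriek⟩⟩

/-- The composite `Psh(C_!) ⟶ Psh(C) ⟶ Set` is local, with the constant presheaf functor as right
adjoint of the direct image. -/
def littleLocal :
    LocalGeomMorphism ((hasUniquePoint C).FullSubcategoryᵒᵖ ⥤ Type u) (Type u) where
  toGeomMorphism := (ofFullSubcategory (hasUniquePoint C)).comp (canonical C).toGeomMorphism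
  upperShriek := Functor.const _
  adjShriek :=
    GeomMorphism.adjOfAboveCentre (canonical C) _ (isSubtopos_ofFullSubcategory _) _
      (((ofFullSubcategory (hasUniquePoint C)).adj.comp
        (evaluationConstAdj C)).rightAdjointUniq (canonical C).adjShriek)
  full :=
    haveI : IsIso (evaluationConstAdj C).counit := inferInstanceAs (IsIso (𝟙 _))
    (evaluationConstAdj C).fullyFaithfulROfIsIsoCounit.full
  faithful :=
    haveI : IsIso (evaluationConstAdj C).counit := inferInstanceAs (IsIso (𝟙 _))
    (evaluationConstAdj C).fullyFaithfulROfIsIsoCounit.faithful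

/-- Here q^* and q^! are both the constant presheaf functor, so `isIso_phi_of_iso` applies with
identities. -/
theorem isSubquality_ofFullSubcategory :
    (canonical C).IsSubquality (ofFullSubcategory (hasUniquePoint C)) :=
  ⟨isSubtopos_ofFullSubcategory _, isAbove_centre_ofFullSubcategory C,
    littleLocal C, rfl, (littleLocal C).isIso_phi_of_iso fun _ => ⟨Iso.refl _⟩⟩

variable {C}

theorem isAbove_of_isSubquality (hpoint : ∀ X : C, Nonempty (⊤_ C ⟶ X))
    (hC : HasEnoughLittleFigures C) {F : Type u₁} [Category.{v₁} F]
    {k : GeomMorphism F (Cᵒᵖ ⥤ Type u)} (hk : (canonical C).IsSubquality k) :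
    (ofFullSubcategory (hasUniquePoint C)).IsAbove k := by
  refine isAbove_ofFullSubcategory _ k fun X => ?_
  rw [← pseudoConstants_eq_factorsThrough hC]
  have := k.preservesFiniteLimits
  have := GeomMorphism.isIso_inverse_map_of_isSubquality hk (diagonal C (⊤_ C ⟶ X))
  obtain ⟨u, v, h⟩ := isPullback_pseudoConstants hpoint X
  exact (h.map k.inverse).isIso_fst_of_isIso

end UniquePoint

end PresheafTopos

end

theorem mainTheorem3 (C : Type u) [SmallCategory C] [HasTerminal C]
    (hpoint : ∀ X : C, Nonempty (⊤_ C ⟶ X))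
    (hC : PresheafTopos.HasEnoughLittleFigures C) :
    LocalGeomMorphism.IsLevelEpsilon.{u, u, u, u + 1, u + 1, u + 1, w, w'} (PresheafTopos.canonical C)
        (PresheafTopos.ofFullSubcategory (PresheafTopos.hasUniquePoint C)) ∧
      LocalGeomMorphism.IsLargestSubquality.{u, u, u, u + 1, u + 1, u + 1, w, w'} (PresheafTopos.canonical C)
        (PresheafTopos.ofFullSubcategory (PresheafTopos.hasUniquePoint C)) :=
  have h := PresheafTopos.isSubquality_ofFullSubcategory C
  ⟨⟨⟨h, PresheafTopos.isEssential_ofFullSubcategory _⟩,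
      fun _ _ _ hk _ => PresheafTopos.isAbove_of_isSubquality hpoint hC hk⟩,
    h, fun _ _ _ hk => PresheafTopos.isAbove_of_isSubquality hpoint hC hk⟩
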